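/- Let $(\mathcal{T},\mathcal{A})$ be a measurable space, let $M>0$, and let $\mathcal{F}$ be a class of functions from $\mathcal{T}$ into $[-M,M]$. Suppose that $\mathcal{F}$ is a uniform Glivenko–Cantelli class, i.e. its elements are measurable and, for every $\epsilon>0$, $$\lim_{n\to\infty}\ \sup_{P}\ P^{\infty}\Big(\sup_{n'\ge n}\ \sup_{f\in\mathcal{F}}\Big|\frac1{n'}\sum_{i=1}^{n'} f(T_i)-\mathbb{E}_{T\sim P}[f(T)]\Big|>\epsilon\Big)=0,$$ where $P$ ranges over all probability measures on $\mathcal{T}$, the $T_i$ are independent copies of $T\sim P$, and $P^\infty$ is the infinite product measure (outer measure if the event is not measurable). For $\gamma>0$, a finite nonempty set $s\subset\mathcal{T}$ is $\gamma$-shattered by $\mathcal{F}$ if there is $b:s\to[-M,M]$ such that for every $l:s\to\{-1,1\}$ some $f\in\mathcal{F}$ satisfies $l(t)\,(f(t)-b(t))\ge\gamma$ for all $t\in s$. Let $d(\gamma)$ be the fat-shattering dimension of $\mathcal{F}$ with margin $\gamma$: the maximal cardinality of a $\gamma$-shattered set ($0$ if there is no such set, $\infty$ if the cardinalities are unbounded).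 For $n\ge1$ and $\mathbf{t}=(t_1,\dots,t_n)\in\mathcal{T}^n$ let $d_{p,\mathbf{t}}(f,g)=\big(\frac1n\sum_{i=1}^n|f(t_i)-g(t_i)|^p\big)^{1/p}$ for an integer $p\ge1$ and $d_{\infty,\mathbf{t}}(f,g)=\max_i|f(t_i)-g(t_i)|$. Let $\mathcal{M}_p(\epsilon,\mathcal{F},n)$ be the supremum over $\mathbf{t}\in\mathcal{T}^n$ of the maximal cardinality (possibly infinite) of a subset of $\mathcal{F}$ any two distinct elements of which are at $d_{p,\mathbf{t}}$-distance at least $\epsilon$. Then $d(\gamma)<\infty$ for every $\gamma\in(0,M]$, and for all $\epsilon\in(0,2M]$ and all integers $n\ge1$: 1. for every integer $p\ge1$, $$\mathcal{M}_p(\epsilon,\mathcal{F},n)\le 2^{2(K_\epsilon(p)+1)}\left(\frac{6272\,e\,K_\epsilon(p)}{3}\left(\frac{2M}{\epsilon}\right)^{2p+1}\right)^{2K_\epsilon(p)\,d(\epsilon/45)},\qquad K_\epsilon(p)=\Big\lceil (p+2)\log_2\Big\lceil\frac{112M}{\epsilon}\Big\rceil\Big\rceil ;$$ 2. if $d(\epsilon/4)\le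 4Mn/\epsilon$ (in particular, if $n\ge d(\epsilon/4)$), then $$\mathcal{M}_\infty(\epsilon,\mathcal{F},n)\le 2\left(\frac{16M^2n}{\epsilon^2}\right)^{d(\epsilon/4)\,\log_2\left(\frac{4Men}{d(\epsilon/4)\,\epsilon}\right)},$$ where the exponent is read as $0$ when $d(\epsilon/4)=0$. -/

import Mathlib

open scoped ENNReal

noncomputable section

/-- `F` is a uniform Glivenko-Cantelli class of measurable functions on `T`: for every `ε > 0`,
`sup_P ℙ(sup_{n' ≥ n} sup_{f ∈ F} |(1/n') ∑_{i < n'} f (T_i) - E_P f| > ε)` tends to `0` as `n → ∞`,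
where `T_0, T_1, …` are the coordinates of the infinite product space, `ℙ` is the infinite product
of copies of `P`, and `P` ranges over all probability measures on `T`.  A supremum exceeds `ε` iff
one of its terms does; on an event that is not measurable, `ℙ` is the outer measure. -/
def IsUniformGC {T : Type*} [MeasurableSpace T] (F : Set (T → ℝ)) : Prop :=
  (∀ f ∈ F, Measurable f) ∧
  ∀ ε : ℝ, 0 < ε →
    Filter.Tendsto
      (fun n : ℕ => ⨆ P : MeasureTheory.ProbabilityMeasure T,
        (MeasureTheory.Measure.infinitePi fun _ : ℕ => (P : MeasureTheory.Measure T))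
          {ω : ℕ → T | ∃ n' : ℕ, n ≤ n' ∧ ∃ f ∈ F,
            ε < |(1 / (n' : ℝ)) * ∑ i ∈ Finset.range n', f (ω i)
                  - ∫ t, f t ∂(P : MeasureTheory.Measure T)|})
      Filter.atTop (nhds 0)

/-- The empirical pseudo-distance `d_{p, t}` on functions `T → ℝ` at the points
`t = (t_1, …, t_n)`, for `p ∈ ℕ* ∪ {∞}` and `n ≥ 1`. -/
def empDist {T : Type*} (p : ℕ∞) {n : ℕ} (t : Fin n → T) (f g : T → ℝ) : ℝ :=
  if p = ⊤ then ⨆ i : Fin n, |f (t i) - g (t i)|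
  else ((1 / (n : ℝ)) * ∑ i : Fin n, |f (t i) - g (t i)| ^ p.toNat) ^ (1 / (p.toNat : ℝ))

/-- `A` is `ε`-separated for `ρ`: distinct points are at distance at least `ε`. -/
def IsEpsSeparated {E : Type*} (ρ : E → E → ℝ) (ε : ℝ) (A : Set E) : Prop :=
  ∀ e ∈ A, ∀ e' ∈ A, e ≠ e' → ε ≤ ρ e e'

/-- The `ε`-packing number of `A`: the maximal cardinality of an `ε`-separated subset of `A`,
infinite if there is no maximum. -/
def packingNum {E : Type*} (ρ : E → E → ℝ) (ε : ℝ) (A : Set E) : ℕ∞ :=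
  ⨆ (B : Set E) (_ : B ⊆ A ∧ IsEpsSeparated ρ ε B), B.encard

/-- The uniform packing number `M_p(ε, F, n)`. -/
def uniformPackingNum {T : Type*} (p : ℕ∞) (ε : ℝ) (F : Set (T → ℝ)) (n : ℕ) : ℕ∞ :=
  ⨆ t : Fin n → T, packingNum (empDist p t) ε F

/-- The finite nonempty set `s` is `γ`-shattered by the class `F` of `S`-valued functions, with
a witness `b` that takes its values in `S`. -/
def FatShatters {T : Type*} (S : Set ℝ) (F : Set (T → ℝ)) (γ : ℝ) (s : Finset T) : Prop :=
  s.Nonempty ∧ ∃ b : T → ℝ, (∀ t ∈ s, b t ∈ S) ∧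
    ∀ l : T → ℝ, (∀ t ∈ s, l t = -1 ∨ l t = 1) →
      ∃ f ∈ F, ∀ t ∈ s, γ ≤ l t * (f t - b t)

/-- The fat-shattering dimension with margin `γ` of the class `F` of `S`-valued functions: the
maximal cardinality of a `γ`-shattered set, infinite if these cardinalities are unbounded, and
zero if no nonempty set is `γ`-shattered. -/
def fatDim {T : Type*} (S : Set ℝ) (F : Set (T → ℝ)) (γ : ℝ) : ℕ∞ :=
  ⨆ (s : Finset T) (_ : FatShatters S F γ s), (s.card : ℕ∞)

/-- `K_ε(p) = ⌈(p + 2) log₂ ⌈112 M / ε⌉⌉`. -/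
def sauerK (M ε : ℝ) (p : ℕ) : ℕ :=
  ⌈((p : ℝ) + 2) * Real.logb 2 ((⌈112 * M / ε⌉ : ℤ) : ℝ)⌉₊

end

open scoped ENNReal

/-! The Glivenko–Cantelli hypothesis serves only to make the fat-shattering dimension finite. If
arbitrarily large sets are shattered, put the uniform law on one much larger than the sample size
`n`. Two functions of the class realize opposite signs on the sampled points and off them; their
empirical means differ by at least `2γ`, their true means by less than `γ`, so one of them deviates
by more than `γ / 2`, whatever the sample (`exists_deviation`).

The packing bounds are combinatorial. Discretize the witnesses to a grid and let `s(A)` be the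
number of patterns (partial assignments of grid levels to coordinates) shattered by a finite class
`A`. Splitting `A` at a level into an upper part `P` and a lower part `N` gives `s(P) + s(N) ≤
s(A)`. Averaging over pairs yields a split with `|A|² ≤ 4^E |P| |N|`, and `4ab ≤ (a + b)²` turns
this by induction into `|A| ≤ s(A)^E`. Supports of shattered patterns are fat-shattered sets, so
`s(A)` is at most the number of patterns with support of size at most `d`.

For `L_∞`, two separated functions differ on at least one coordinate, a proportion `1 / n`. For
`L_p` they differ by `ε / 2` on a proportion independent of `n`; a random sample of length of order
`log |A|` retains this, and the resulting inequality for `log |A|` is free of `n`. -/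

/-- `A` shatters the pattern `g` with margin `γ`: the coordinates `i` with `g i = some k` are
shattered with witness `c k`. -/
def ShattersPattern {α ι κ : Type*} (x : α → ι → ℝ) (c : κ → ℝ) (γ : ℝ) (A : Finset α)
    (g : ι → Option κ) : Prop :=
  ∀ l : ι → Prop, ∃ f ∈ A, ∀ i k, g i = some k →
    (l i → c k + γ ≤ x f i) ∧ (¬ l i → x f i ≤ c k - γ)

open Classical in
/-- The finite set of patterns shattered by `A`. -/
noncomputable def shatteredPatterns {α ι κ : Type*} [Fintype ι] [Fintype κ] (x : α → ι → ℝ)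
    (c : κ → ℝ) (γ : ℝ) (A : Finset α) : Finset (ι → Option κ) :=
  Finset.univ.filter (ShattersPattern x c γ A)

/-! ### Shattered patterns and balanced splits. -/

section Patterns

variable {α ι κ : Type*} {x : α → ι → ℝ} {c : κ → ℝ} {γ : ℝ}

lemma ShattersPattern.mono {A B : Finset α} (h : A ⊆ B) {g : ι → Option κ}
    (hg : ShattersPattern x c γ A g) : ShattersPattern x c γ B g := fun l => by
  obtain ⟨f, hf, hfl⟩ := hg l
  exact ⟨f, h hf, hfl⟩

variable [Fintype ι] [Fintype κ]

lemma mem_shatteredPatterns {A : Finset α} {g : ι → Option κ} :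
    g ∈ shatteredPatterns x c γ A ↔ ShattersPattern x c γ A g := by
  simp [shatteredPatterns]

lemma shatteredPatterns_card_pos {A : Finset α} (hA : A.Nonempty) :
    1 ≤ (shatteredPatterns x c γ A).card := by
  obtain ⟨f, hf⟩ := hA
  exact Finset.card_pos.2 ⟨fun _ => none, mem_shatteredPatterns.2 fun l => ⟨f, hf, by simp⟩⟩

/-- Splitting a class at one coordinate is superadditive for the number of shattered patterns. -/
lemma card_shatteredPatterns_add_le (hγ : 0 < γ) {A P N : Finset α} (hP : P ⊆ A) (hN : N ⊆ A)
    (i : ι) (k : κ) (hPk : ∀ f ∈ P, c k + γ ≤ x f i) (hNk : ∀ f ∈ N, x f i ≤ c k - γ) :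
    (shatteredPatterns x c γ P).card + (shatteredPatterns x c γ N).card
      ≤ (shatteredPatterns x c γ A).card := by
  classical
  set U := shatteredPatterns x c γ P ∪ shatteredPatterns x c γ N with hU
  set I := shatteredPatterns x c γ P ∩ shatteredPatterns x c γ N with hI
  -- A level `k'` at `i` would need a member of `P` below it and a member of `N` above it, although
  -- `P` lies above `N` at `i`.
  have hnone : ∀ g ∈ I, g i = none := by
    intro g hg
    rw [hI, Finset.mem_inter, mem_shatteredPatterns, mem_shatteredPatterns] at hg
    by_contra hne
    obtain ⟨k', hk'⟩ := Option.ne_none_iff_exists'.1 hne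
    obtain ⟨f, hf, hfl⟩ := hg.1 fun _ => False
    obtain ⟨f', hf', hfl'⟩ := hg.2 fun _ => True
    have h1 := (hfl i k' hk').2 not_false
    have h2 := (hfl' i k' hk').1 trivial
    linarith [hPk f hf, hNk f' hf']
  -- Patterns counted twice are compensated by new ones: `P` supplies the plus sign at `(i, k)` and
  -- `N` the minus sign, while neither part alone shatters a pattern with level `k` at `i`.
  set J := I.image fun g => Function.update g i (some k) with hJ
  have hJcard : J.card = I.card := by
    refine Finset.card_image_of_injOn fun g hg g' hg' h => ?_
    funext j
    by_cases hj : j = i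
    · subst hj
      rw [hnone g hg, hnone g' hg']
    · simpa [hj] using congrFun h j
  have hJA : J ⊆ shatteredPatterns x c γ A := by
    intro g hg
    obtain ⟨g', hg', rfl⟩ := Finset.mem_image.1 hg
    have hn := hnone g' hg'
    rw [hI, Finset.mem_inter, mem_shatteredPatterns, mem_shatteredPatterns] at hg'
    refine mem_shatteredPatterns.2 fun l => ?_
    by_cases hl : l i
    · obtain ⟨f, hf, hfl⟩ := hg'.1 l
      refine ⟨f, hP hf, fun j k' hk' => ?_⟩
      by_cases hj : j = i
      · subst hj
        have : k = k' := by simpa using hk'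
        subst this
        exact ⟨fun _ => hPk f hf, fun h => absurd hl h⟩
      · exact hfl j k' (by simpa [hj] using hk')
    · obtain ⟨f, hf, hfl⟩ := hg'.2 l
      refine ⟨f, hN hf, fun j k' hk' => ?_⟩
      by_cases hj : j = i
      · subst hj
        have : k = k' := by simpa using hk'
        subst this
        exact ⟨fun h => absurd h hl, fun _ => hNk f hf⟩
      · exact hfl j k' (by simpa [hj] using hk')
  have hUA : U ⊆ shatteredPatterns x c γ A := by
    intro g hg
    rcases Finset.mem_union.1 hg with h | h
    · exact mem_shatteredPatterns.2 ((mem_shatteredPatterns.1 h).mono hP)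
    · exact mem_shatteredPatterns.2 ((mem_shatteredPatterns.1 h).mono hN)
  have hdisj : Disjoint U J := by
    rw [Finset.disjoint_left]
    intro g hg hgJ
    obtain ⟨g', -, rfl⟩ := Finset.mem_image.1 hgJ
    have hs : Function.update g' i (some k) i = some k := by simp
    rcases Finset.mem_union.1 hg with h | h
    · obtain ⟨f, hf, hfl⟩ := mem_shatteredPatterns.1 h fun _ => False
      have := (hfl i k hs).2 not_false
      linarith [hPk f hf]
    · obtain ⟨f, hf, hfl⟩ := mem_shatteredPatterns.1 h fun _ => True
      have := (hfl i k hs).1 trivial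
      linarith [hNk f hf]
  calc _ = U.card + I.card := (Finset.card_union_add_card_inter _ _).symm
    _ = (U ∪ J).card := by rw [Finset.card_union_of_disjoint hdisj, hJcard]
    _ ≤ _ := Finset.card_le_card (Finset.union_subset hUA hJA)

open Classical in
/-- A class whose members are pairwise separated on a proportion `π` of the coordinates has a
balanced split at some coordinate and some threshold. -/
lemma exists_balanced_split {B : Finset α} (hB : 2 ≤ B.card) {σ π : ℝ}
    (hι : 0 < Fintype.card ι) (hπ : 0 < π)
    (hsep : ∀ f ∈ B, ∀ g ∈ B, f ≠ g → π * Fintype.card ι ≤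
      ((Finset.univ.filter fun i => σ ≤ |x f i - x g i|).card : ℝ))
    (hc : ∀ f ∈ B, ∀ g ∈ B, ∀ i, σ ≤ x f i - x g i → ∃ k, x g i ≤ c k - γ ∧ c k + γ ≤ x f i) :
    ∃ i k, (B.card : ℝ) ^ 2 * π ≤ 4 * Fintype.card κ *
      ((B.filter fun f => c k + γ ≤ x f i).card * (B.filter fun f => x f i ≤ c k - γ).card) := by
  set P : ι × κ → Finset α := fun z => B.filter fun f => c z.2 + γ ≤ x f z.1 with hPdef
  set N : ι × κ → Finset α := fun z => B.filter fun f => x f z.1 ≤ c z.2 - γ with hNdef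
  set m : ℝ := (B.card : ℝ) with hm
  have hm2 : (2 : ℝ) ≤ m := by rw [hm]; exact_mod_cast hB
  -- Double counting: each ordered pair is split, in one order or the other, at one level or more of
  -- every separating coordinate.
  have hpair : ∀ w ∈ B.offDiag, π * Fintype.card ι ≤
      ∑ z : ι × κ, ((if w.1 ∈ P z ∧ w.2 ∈ N z then (1 : ℝ) else 0) +
        (if w.1 ∈ N z ∧ w.2 ∈ P z then (1 : ℝ) else 0)) := by
    rintro ⟨f, g⟩ hw
    obtain ⟨hf, hg, hfg⟩ := Finset.mem_offDiag.1 hw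
    refine (hsep f hf g hg hfg).trans ?_
    rw [Fintype.sum_prod_type, Finset.card_filter, Nat.cast_sum]
    refine Finset.sum_le_sum fun i _ => ?_
    split_ifs with h
    · have key : ∃ k, (1 : ℝ) ≤ (if f ∈ P (i, k) ∧ g ∈ N (i, k) then (1 : ℝ) else 0) +
          (if f ∈ N (i, k) ∧ g ∈ P (i, k) then (1 : ℝ) else 0) := by
        rcases le_abs.1 h with h | h
        · obtain ⟨k, h1, h2⟩ := hc f hf g hg i h
          refine ⟨k, ?_⟩
          rw [if_pos ⟨Finset.mem_filter.2 ⟨hf, h2⟩, Finset.mem_filter.2 ⟨hg, h1⟩⟩]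
          split_ifs <;> norm_num
        · obtain ⟨k, h1, h2⟩ := hc g hg f hf i (by linarith)
          refine ⟨k, ?_⟩
          rw [if_pos (c := f ∈ N (i, k) ∧ _) ⟨Finset.mem_filter.2 ⟨hf, h1⟩,
            Finset.mem_filter.2 ⟨hg, h2⟩⟩]
          split_ifs <;> norm_num
      obtain ⟨k, hk⟩ := key
      rw [Nat.cast_one]
      refine hk.trans (Finset.single_le_sum (f := fun k => (if f ∈ P (i, k) ∧ g ∈ N (i, k) then
        (1 : ℝ) else 0) + (if f ∈ N (i, k) ∧ g ∈ P (i, k) then (1 : ℝ) else 0))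
        (fun k _ => by positivity) (Finset.mem_univ k))
    · rw [Nat.cast_zero]
      exact Finset.sum_nonneg fun k _ => by positivity
  have hle : ∀ z : ι × κ, ∑ w ∈ B.offDiag, ((if w.1 ∈ P z ∧ w.2 ∈ N z then (1 : ℝ) else 0) +
        (if w.1 ∈ N z ∧ w.2 ∈ P z then (1 : ℝ) else 0)) ≤ 2 * ((P z).card * (N z).card) := by
    intro z
    rw [Finset.sum_add_distrib, Finset.sum_boole, Finset.sum_boole]
    have h1 : (B.offDiag.filter fun w => w.1 ∈ P z ∧ w.2 ∈ N z).card ≤ (P z).card * (N z).card := by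
      rw [← Finset.card_product]
      refine Finset.card_le_card fun w hw => Finset.mem_product.2 (Finset.mem_filter.1 hw).2
    have h2 : (B.offDiag.filter fun w => w.1 ∈ N z ∧ w.2 ∈ P z).card ≤ (N z).card * (P z).card := by
      rw [← Finset.card_product]
      refine Finset.card_le_card fun w hw => Finset.mem_product.2 (Finset.mem_filter.1 hw).2
    have h1' : ((B.offDiag.filter fun w => w.1 ∈ P z ∧ w.2 ∈ N z).card : ℝ) ≤
      (P z).card * (N z).card := by exact_mod_cast h1
    have h2' : ((B.offDiag.filter fun w => w.1 ∈ N z ∧ w.2 ∈ P z).card : ℝ) ≤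
      (N z).card * (P z).card := by exact_mod_cast h2
    linarith
  have htot : m * (m - 1) * (π * Fintype.card ι) ≤
      ∑ z : ι × κ, 2 * (((P z).card : ℝ) * (N z).card) := by
    calc m * (m - 1) * (π * Fintype.card ι)
        = ∑ w ∈ B.offDiag, π * Fintype.card ι := by
          rw [Finset.sum_const, Finset.offDiag_card, nsmul_eq_mul,
            Nat.cast_sub (Nat.le_mul_self _)]
          push_cast
          rw [← hm]; ring
      _ ≤ _ := Finset.sum_le_sum hpair
      _ = _ := Finset.sum_comm
      _ ≤ _ := Finset.sum_le_sum fun z _ => hle z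
  have hιr : (0 : ℝ) < Fintype.card ι := by exact_mod_cast hι
  by_contra hcon
  push Not at hcon
  have hpos : 0 < m * (m - 1) * (π * Fintype.card ι) :=
    mul_pos (mul_pos (by linarith) (by linarith)) (mul_pos hπ hιr)
  have hne : (Finset.univ : Finset (ι × κ)).Nonempty := by
    by_contra hemp
    rw [Finset.not_nonempty_iff_eq_empty] at hemp
    rw [hemp, Finset.sum_empty] at htot
    linarith
  have hκ : (0 : ℝ) < Fintype.card κ := by
    obtain ⟨z, -⟩ := hne
    exact_mod_cast Fintype.card_pos_iff.2 ⟨z.2⟩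
  have hlt : ∑ z : ι × κ, 2 * (((P z).card : ℝ) * (N z).card) <
      ∑ z : ι × κ, m ^ 2 * π / (2 * Fintype.card κ) := by
    refine Finset.sum_lt_sum_of_nonempty hne fun z _ => ?_
    rw [lt_div_iff₀ (by positivity)]
    have := hcon z.1 z.2
    simp only [hPdef, hNdef]
    linarith
  rw [Finset.sum_const, Finset.card_univ, Fintype.card_prod, nsmul_eq_mul] at hlt
  push_cast at hlt
  have heq : (Fintype.card ι : ℝ) * Fintype.card κ * (m ^ 2 * π / (2 * Fintype.card κ)) =
      m ^ 2 / 2 * (π * Fintype.card ι) := by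
    field_simp
  rw [heq] at hlt
  -- This gives `m (m - 1) < m² / 2`, impossible for `m ≥ 2`.
  have := lt_of_mul_lt_mul_right (htot.trans_lt hlt) (by positivity)
  nlinarith

/-- The number of pairwise separated functions is controlled by the number of shattered
patterns. -/
lemma card_le_card_shatteredPatterns_rpow (hγ : 0 < γ) {σ π E : ℝ}
    (hι : 0 < Fintype.card ι) (hπ : 0 < π) (hE : 0 ≤ E)
    (hL : 4 * Fintype.card κ ≤ (4 : ℝ) ^ E * π) (A : Finset α) (hA : A.Nonempty)
    (hsep : ∀ f ∈ A, ∀ g ∈ A, f ≠ g → π * Fintype.card ι ≤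
      ((Finset.univ.filter fun i => σ ≤ |x f i - x g i|).card : ℝ))
    (hc : ∀ f ∈ A, ∀ g ∈ A, ∀ i, σ ≤ x f i - x g i → ∃ k, x g i ≤ c k - γ ∧ c k + γ ≤ x f i) :
    (A.card : ℝ) ≤ ((shatteredPatterns x c γ A).card : ℝ) ^ E := by
  classical
  induction hn : A.card using Nat.strong_induction_on generalizing A with
  | _ n ih =>
    subst hn
    have hφ : (1 : ℝ) ≤ (shatteredPatterns x c γ A).card := by
      exact_mod_cast shatteredPatterns_card_pos hA
    rcases Nat.lt_or_ge A.card 2 with h2 | h2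
    · calc (A.card : ℝ) ≤ 1 := by exact_mod_cast Nat.lt_succ_iff.1 h2
        _ ≤ _ := Real.one_le_rpow hφ hE
    obtain ⟨i, k, hik⟩ := exists_balanced_split h2 hι hπ
      (fun f hf g hg => by convert hsep f hf g hg) hc
    set P := A.filter fun f => c k + γ ≤ x f i with hP
    set N := A.filter fun f => x f i ≤ c k - γ with hN
    have hm : (0 : ℝ) < A.card := by exact_mod_cast hA.card_pos
    have hprod : (0 : ℝ) < 4 * Fintype.card κ * (P.card * N.card) :=
      lt_of_lt_of_le (by positivity) hik
    have hPpos : P.Nonempty := by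
      rw [← Finset.card_pos]
      by_contra h
      rw [Nat.eq_zero_of_not_pos h] at hprod
      simp at hprod
    have hNpos : N.Nonempty := by
      rw [← Finset.card_pos]
      by_contra h
      rw [Nat.eq_zero_of_not_pos h] at hprod
      simp at hprod
    have hPA : P ⊆ A := Finset.filter_subset _ _
    have hNA : N ⊆ A := Finset.filter_subset _ _
    have hPk : ∀ f ∈ P, c k + γ ≤ x f i := fun f hf => (Finset.mem_filter.1 hf).2
    have hNk : ∀ f ∈ N, x f i ≤ c k - γ := fun f hf => (Finset.mem_filter.1 hf).2
    have hPlt : P.card < A.card := by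
      obtain ⟨g, hg⟩ := hNpos
      refine Finset.card_lt_card (Finset.ssubset_iff_subset_ne.2 ⟨hPA, fun h => ?_⟩)
      linarith [hPk g (h ▸ hNA hg), hNk g hg]
    have hNlt : N.card < A.card := by
      obtain ⟨g, hg⟩ := hPpos
      refine Finset.card_lt_card (Finset.ssubset_iff_subset_ne.2 ⟨hNA, fun h => ?_⟩)
      linarith [hNk g (h ▸ hPA hg), hPk g hg]
    have iP := ih P.card hPlt P hPpos (fun f hf g hg => hsep f (hPA hf) g (hPA hg))
      (fun f hf g hg => hc f (hPA hf) g (hPA hg)) rfl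
    have iN := ih N.card hNlt N hNpos (fun f hf g hg => hsep f (hNA hf) g (hNA hg))
      (fun f hf g hg => hc f (hNA hf) g (hNA hg)) rfl
    have habs : ((shatteredPatterns x c γ P).card : ℝ) + (shatteredPatterns x c γ N).card ≤
        (shatteredPatterns x c γ A).card := by
      exact_mod_cast card_shatteredPatterns_add_le hγ hPA hNA i k hPk hNk
    set a : ℝ := ((shatteredPatterns x c γ P).card : ℝ)
    set b : ℝ := ((shatteredPatterns x c γ N).card : ℝ)
    set s : ℝ := ((shatteredPatterns x c γ A).card : ℝ)
    have ha : 0 ≤ a := Nat.cast_nonneg _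
    have hb : 0 ≤ b := Nat.cast_nonneg _
    have hsq : (A.card : ℝ) ^ 2 ≤ (s ^ E) ^ 2 := by
      have h1 : (A.card : ℝ) ^ 2 * π ≤ (4 : ℝ) ^ E * (P.card * N.card) * π := by
        calc _ ≤ _ := hik
          _ ≤ (4 : ℝ) ^ E * π * (P.card * N.card) :=
            mul_le_mul_of_nonneg_right hL (by positivity)
          _ = _ := by ring
      calc (A.card : ℝ) ^ 2 ≤ (4 : ℝ) ^ E * (P.card * N.card) := le_of_mul_le_mul_right h1 hπ
        _ ≤ (4 : ℝ) ^ E * (a ^ E * b ^ E) := by gcongr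
        _ = (4 * (a * b)) ^ E := by
          rw [Real.mul_rpow (by norm_num) (by positivity), Real.mul_rpow ha hb]
        _ ≤ (s * s) ^ E := by
          refine Real.rpow_le_rpow (by positivity) ?_ hE
          -- `4ab ≤ (a + b)² ≤ s²`.
          nlinarith [sq_nonneg (a - b)]
        _ = (s ^ E) ^ 2 := by rw [Real.mul_rpow (by linarith) (by linarith), sq]
    exact le_of_sq_le_sq hsq (by positivity)

/-! ### Counting patterns and extracting coordinates. -/

open Classical in
/-- The number of patterns whose support has at most `d` elements. -/
lemma card_patterns_le {n b d : ℕ} (hn : 0 < n) (hd : 0 < d) {R : ℝ} (hR : 0 < R) (hb : b ≤ R)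
    (hdR : d ≤ n * R) (Φ : Finset (Fin n → Option (Fin b)))
    (hΦ : ∀ g ∈ Φ, (Finset.univ.filter fun i => g i ≠ none).card ≤ d) :
    (Φ.card : ℝ) ≤ (Real.exp 1 * n * R / d) ^ d := by
  have hn' : (0 : ℝ) < n := by exact_mod_cast hn
  have hd' : (0 : ℝ) < d := by exact_mod_cast hd
  -- Weight each pattern by `u ^ |support|`: the total weight is `(1 + b u) ^ n ≤ e ^ d`, and every
  -- pattern of `Φ` weighs at least `u ^ d` because `u ≤ 1`.
  set u : ℝ := d / (n * R) with hu
  have hu0 : 0 < u := by positivity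
  have hu1 : u ≤ 1 := (div_le_one (by positivity)).2 hdR
  have h1 : (Φ.card : ℝ) * u ^ d ≤ (1 + b * u) ^ n := by
    calc (Φ.card : ℝ) * u ^ d = ∑ g ∈ Φ, u ^ d := by rw [Finset.sum_const, nsmul_eq_mul]
      _ ≤ ∑ g ∈ Φ, ∏ i, (if g i ≠ none then u else 1) := by
        refine Finset.sum_le_sum fun g hg => ?_
        rw [← Finset.prod_filter, Finset.prod_const]
        exact pow_le_pow_of_le_one hu0.le hu1 (hΦ g hg)
      _ ≤ ∑ g : Fin n → Option (Fin b), ∏ i, (if g i ≠ none then u else 1) :=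
        Finset.sum_le_sum_of_subset_of_nonneg (Finset.subset_univ _) fun g _ _ =>
          Finset.prod_nonneg fun i _ => by split_ifs <;> positivity
      _ = (∑ o : Option (Fin b), (if o ≠ none then u else 1)) ^ n :=
        (Fintype.sum_pow (fun o : Option (Fin b) => if o ≠ none then u else 1) n).symm
      _ = (1 + b * u) ^ n := by simp [Fintype.sum_option]
  have h2 : (1 + b * u) ^ n ≤ Real.exp 1 ^ d := by
    calc (1 + b * u) ^ n ≤ (Real.exp (d / n)) ^ n := by
          refine pow_le_pow_left₀ (by positivity) ?_ n
          calc 1 + b * u ≤ 1 + R * u := by gcongr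
            _ = d / n + 1 := by rw [hu]; field_simp; ring
            _ ≤ _ := Real.add_one_le_exp _
      _ = Real.exp 1 ^ d := by
        rw [← Real.exp_nat_mul, ← Real.exp_nat_mul]
        congr 1
        field_simp
  have h3 : (Real.exp 1 * n * R / d) ^ d = Real.exp 1 ^ d / u ^ d := by
    rw [← div_pow, hu]
    congr 1
    field_simp
  rw [h3, le_div_iff₀ (by positivity)]
  exact h1.trans h2

open Classical in
/-- Random extraction: if each of the predicates holds at a proportion `π` of the points, there is
a short sequence of points on which each of them has frequency at least `π / 4`. -/
lemma exists_sample {β : Type*} {n q : ℕ} (hn : 0 < n) (Q : Finset β) (P : β → Fin n → Prop)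
    {π : ℝ} (hP : ∀ w ∈ Q, π * n ≤ ((Finset.univ.filter (P w)).card : ℝ))
    (hq : (Q.card : ℝ) < Real.exp (π * q / 4)) :
    ∃ s : Fin q → Fin n, ∀ w ∈ Q,
      π / 4 * q ≤ ((Finset.univ.filter fun j => P w (s j)).card : ℝ) := by
  by_contra! hcon
  have hn' : (0 : ℝ) < n := by exact_mod_cast hn
  -- Exponential moment method with `2 ^ (-frequency)`: a failing `w` makes the sum large for every
  -- sample, whereas independence makes its average over samples small.
  have hlow : ∀ s : Fin q → Fin n, Real.exp (-(π * q / 4)) ≤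
      ∑ w ∈ Q, ∏ j, (if P w (s j) then (1 / 2 : ℝ) else 1) := by
    intro s
    obtain ⟨w, hw, hlt⟩ := hcon s
    refine le_trans ?_ (Finset.single_le_sum
      (f := fun w => ∏ j, (if P w (s j) then (1 / 2 : ℝ) else 1))
      (fun w _ => Finset.prod_nonneg fun i _ => by split_ifs <;> positivity) hw)
    rw [← Finset.prod_filter, Finset.prod_const]
    have h2 : Real.exp (-1) ≤ 1 / 2 := by
      rw [Real.exp_neg, one_div]
      exact inv_anti₀ (by norm_num) (by linarith [Real.add_one_le_exp (1 : ℝ)])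
    calc Real.exp (-(π * q / 4))
        ≤ Real.exp (-1) ^ (Finset.univ.filter fun j => P w (s j)).card := by
          rw [← Real.exp_nat_mul, Real.exp_le_exp]
          linarith
      _ ≤ _ := pow_le_pow_left₀ (Real.exp_nonneg _) h2 _
  have hup : ∀ w ∈ Q, ∑ s : Fin q → Fin n, ∏ j, (if P w (s j) then (1 / 2 : ℝ) else 1) ≤
      n ^ q * Real.exp (-(π * q / 2)) := by
    intro w hw
    have h := Fintype.sum_pow (fun i : Fin n => if P w i then (1 / 2 : ℝ) else 1) q
    rw [← h]
    have hsum : ∑ i : Fin n, (if P w i then (1 / 2 : ℝ) else 1) ≤ n * Real.exp (-(π / 2)) := by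
      have heq : ∀ i : Fin n, (if P w i then (1 / 2 : ℝ) else 1) =
          1 - (if P w i then 1 else 0) / 2 := fun i => by split_ifs <;> norm_num
      simp_rw [heq]
      rw [Finset.sum_sub_distrib, ← Finset.sum_div, Finset.sum_boole, Finset.sum_const,
        Finset.card_univ, Fintype.card_fin, nsmul_eq_mul]
      have := mul_le_mul_of_nonneg_left (Real.add_one_le_exp (-(π / 2))) hn'.le
      linarith [hP w hw]
    calc _ ≤ (n * Real.exp (-(π / 2))) ^ q :=
          pow_le_pow_left₀ (Finset.sum_nonneg fun i _ => by split_ifs <;> norm_num) hsum q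
      _ = _ := by
        rw [mul_pow, ← Real.exp_nat_mul]
        congr 2; ring
  have hmain : (n : ℝ) ^ q * Real.exp (-(π * q / 4)) ≤
      Q.card * (n ^ q * Real.exp (-(π * q / 2))) := by
    calc (n : ℝ) ^ q * Real.exp (-(π * q / 4))
        = ∑ s : Fin q → Fin n, Real.exp (-(π * q / 4)) := by
          simp [Finset.sum_const, Finset.card_univ]
      _ ≤ ∑ s : Fin q → Fin n, ∑ w ∈ Q, ∏ j, (if P w (s j) then (1 / 2 : ℝ) else 1) :=
        Finset.sum_le_sum fun s _ => hlow s
      _ = _ := Finset.sum_comm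
      _ ≤ ∑ w ∈ Q, (n : ℝ) ^ q * Real.exp (-(π * q / 2)) := Finset.sum_le_sum hup
      _ = _ := by rw [Finset.sum_const, nsmul_eq_mul]
  have hlt : (Q.card : ℝ) * (n ^ q * Real.exp (-(π * q / 2))) <
      Real.exp (π * q / 4) * (n ^ q * Real.exp (-(π * q / 2))) :=
    mul_lt_mul_of_pos_right hq (by positivity)
  have heq : Real.exp (π * q / 4) * (n ^ q * Real.exp (-(π * q / 2))) =
      (n : ℝ) ^ q * Real.exp (-(π * q / 4)) := by
    rw [mul_left_comm, ← Real.exp_add]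
    congr 2; ring
  linarith

end Patterns

/-! ### From patterns to the fat-shattering dimension. -/

section

open MeasureTheory

/-- The coordinates in the support of a shattered pattern form a fat-shattered set. -/
lemma ShattersPattern.card_support_le {T κ : Type*} {n : ℕ} {F : Set (T → ℝ)} {S : Set ℝ}
    {γ : ℝ} (hγ : 0 < γ) {A : Finset (T → ℝ)} (hAF : ↑A ⊆ F) (t : Fin n → T) {c : κ → ℝ}
    (hc : ∀ k, c k ∈ S) {d : ℕ} (hd : fatDim S F γ ≤ d) {g : Fin n → Option κ}
    (hg : ShattersPattern (fun f i => f (t i)) c γ A g)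
    [DecidablePred fun i => g i ≠ none] :
    (Finset.univ.filter fun i => g i ≠ none).card ≤ d := by
  classical
  set s := Finset.univ.filter fun i => g i ≠ none with hs
  have hsome : ∀ i ∈ s, ∃ k, g i = some k := fun i hi =>
    Option.ne_none_iff_exists'.1 (Finset.mem_filter.1 hi).2
  -- Sample points may repeat, but two support coordinates carrying the same point cannot take both
  -- pairs of opposite signs.
  have hinj : Set.InjOn t s := by
    intro i hi j hj hij
    by_contra hne
    obtain ⟨k, hk⟩ := hsome i hi
    obtain ⟨k', hk'⟩ := hsome j hj
    obtain ⟨f, -, hf⟩ := hg fun a => a = i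
    obtain ⟨f', -, hf'⟩ := hg fun a => a = j
    have h1 := (hf i k hk).1 rfl
    have h2 := (hf j k' hk').2 (Ne.symm hne)
    have h3 := (hf' i k hk).2 hne
    have h4 := (hf' j k' hk').1 rfl
    simp only [hij] at h1 h3
    linarith
  rcases s.eq_empty_or_nonempty with h0 | hne
  · simp [h0]
  have hsh : FatShatters S F γ (s.image t) := by
    have hpre : ∀ τ, ∃ i, τ ∈ s.image t → i ∈ s ∧ t i = τ := by
      intro τ
      by_cases h : τ ∈ s.image t
      · obtain ⟨i, hi, hit⟩ := Finset.mem_image.1 h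
        exact ⟨i, fun _ => ⟨hi, hit⟩⟩
      · exact ⟨hne.choose, fun h' => absurd h' h⟩
    choose pre hpre using hpre
    have hk : ∀ τ, ∃ k, τ ∈ s.image t → g (pre τ) = some k := by
      intro τ
      by_cases h : τ ∈ s.image t
      · obtain ⟨k, hk⟩ := hsome _ (hpre τ h).1
        exact ⟨k, fun _ => hk⟩
      · obtain ⟨k, hk⟩ := hsome _ hne.choose_spec
        exact ⟨k, fun h' => absurd h' h⟩
    choose k hk using hk
    refine ⟨hne.image t, fun τ => c (k τ), fun τ _ => hc _, fun l hl => ?_⟩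
    obtain ⟨f, hf, hfl⟩ := hg fun i => l (t i) = 1
    refine ⟨f, hAF hf, fun τ hτ => ?_⟩
    have h := hfl (pre τ) (k τ) (hk τ hτ)
    simp only [(hpre τ hτ).2] at h
    rcases hl τ hτ with h1 | h1
    · have := h.2 (by rw [h1]; norm_num)
      rw [h1]; linarith
    · have := h.1 h1
      rw [h1]; linarith
  have hle : ((s.image t).card : ℕ∞) ≤ d :=
    (le_iSup₂ (f := fun (s : Finset T) (_ : FatShatters S F γ s) => (s.card : ℕ∞)) _ hsh).trans hd
  rw [Finset.card_image_of_injOn hinj] at hle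
  exact_mod_cast hle

/-- A finite class that is pairwise separated by `σ` on a proportion `π` of `n` points. -/
lemma card_le_of_fatDim {T : Type*} {M : ℝ} (hM : 0 < M) {F : Set (T → ℝ)}
    (hF : ∀ f ∈ F, ∀ t : T, f t ∈ Set.Icc (-M) M) {n : ℕ} (hn : 0 < n) (t : Fin n → T)
    {γ η σ π E : ℝ} (hγ : 0 < γ) (hη : 0 < η) (hσ : 2 * γ + η ≤ σ) (hπ : 0 < π) (hE : 0 ≤ E)
    (hL : 4 * (2 * M / η) ≤ (4 : ℝ) ^ E * π)
    {d : ℕ} (hd : fatDim (Set.Icc (-M) M) F γ ≤ d) {A : Finset (T → ℝ)} (hAF : ↑A ⊆ F)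
    (hsep : ∀ f ∈ A, ∀ g ∈ A, f ≠ g → π * n ≤
      ((Finset.univ.filter fun i => σ ≤ |f (t i) - g (t i)|).card : ℝ)) :
    (d = 0 → A.card ≤ 1) ∧ (0 < d → d ≤ n * (2 * M / η) →
      (A.card : ℝ) ≤ ((Real.exp 1 * n * (2 * M / η) / d) ^ d) ^ E) := by
  classical
  rcases A.eq_empty_or_nonempty with rfl | hA
  · refine ⟨by simp, fun _ _ => ?_⟩
    simp only [Finset.card_empty, Nat.cast_zero]
    positivity
  set b : ℕ := ⌊2 * M / η⌋₊ with hb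
  have hbR : (b : ℝ) ≤ 2 * M / η := Nat.floor_le (by positivity)
  -- A grid of step `η`. When `g + σ ≤ f` at a point, `[g + γ, f - γ]` has length at least `η`; its
  -- witness is the first grid level above `g + γ`. As `g + γ > -M`, no level at `-M` is needed.
  set c : Fin b → ℝ := fun k => -M + ((k : ℕ) + 1 : ℝ) * η with hcdef
  have hcS : ∀ k, c k ∈ Set.Icc (-M) M := by
    intro k
    have h1 : ((k : ℕ) + 1 : ℝ) ≤ 2 * M / η := by
      refine le_trans ?_ hbR
      exact_mod_cast k.2
    rw [le_div_iff₀ hη] at h1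
    have h2 : (0 : ℝ) ≤ ((k : ℕ) + 1 : ℝ) * η := by positivity
    constructor <;> simp only [hcdef] <;> linarith
  set x : (T → ℝ) → Fin n → ℝ := fun f i => f (t i) with hx
  have hc : ∀ f ∈ A, ∀ g ∈ A, ∀ i, σ ≤ x f i - x g i →
      ∃ k, x g i ≤ c k - γ ∧ c k + γ ≤ x f i := by
    intro f hf g hg i hi
    have hfM := (hF f (hAF hf) (t i)).2
    have hgM := (hF g (hAF hg) (t i)).1
    simp only [hx] at hi ⊢
    have h0 : 0 < (g (t i) + γ + M) / η := div_pos (by linarith) hη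
    obtain ⟨j, hj⟩ : ∃ j, ⌈(g (t i) + γ + M) / η⌉₊ = j + 1 :=
      Nat.exists_eq_succ_of_ne_zero (Nat.ceil_pos.2 h0).ne'
    have h1 := Nat.le_ceil ((g (t i) + γ + M) / η)
    have h2 := Nat.ceil_lt_add_one h0.le
    rw [hj, Nat.cast_add, Nat.cast_one] at h1 h2
    rw [div_le_iff₀ hη] at h1
    have h3 : ((j : ℝ) + 1) * η < g (t i) + γ + M + η := by
      have := mul_lt_mul_of_pos_right h2 hη
      rwa [add_mul (_ / η), div_mul_cancel₀ _ hη.ne', one_mul] at this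
    have hjb : j < b := by
      rw [← Nat.succ_le_iff]
      refine Nat.le_floor ?_
      rw [le_div_iff₀ hη, Nat.succ_eq_add_one, Nat.cast_add, Nat.cast_one]
      linarith
    refine ⟨⟨j, hjb⟩, ?_, ?_⟩ <;> simp only [hcdef] <;> linarith
  have hcard := card_le_card_shatteredPatterns_rpow (x := x) (c := c) (σ := σ) (π := π) (E := E) hγ
    (by simpa using hn) hπ hE
    (le_trans (by rw [Fintype.card_fin]; linarith) hL) A hA
    (fun f hf g hg hfg => by
      rw [Fintype.card_fin]
      exact hsep f hf g hg hfg) hc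
  have hsupp : ∀ g ∈ shatteredPatterns x c γ A,
      (Finset.univ.filter fun i => g i ≠ none).card ≤ d := fun g hg =>
    (mem_shatteredPatterns.1 hg).card_support_le hγ hAF t hcS hd
  refine ⟨fun h0 => ?_, fun hd0 hdR => ?_⟩
  · have h1 : (shatteredPatterns x c γ A).card ≤ 1 := by
      refine Finset.card_le_one.2 fun g hg g' hg' => ?_
      have key : ∀ g ∈ shatteredPatterns x c γ A, g = fun _ => none := by
        intro g hg
        have := hsupp g hg
        rw [h0, Nat.le_zero, Finset.card_eq_zero, Finset.filter_eq_empty_iff] at this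
        funext i
        simpa using this (Finset.mem_univ i)
      rw [key g hg, key g' hg']
    have h2 : (A.card : ℝ) ≤ 1 := hcard.trans
      (Real.rpow_le_one (Nat.cast_nonneg _) (by exact_mod_cast h1) hE)
    exact_mod_cast h2
  · exact hcard.trans (Real.rpow_le_rpow (Nat.cast_nonneg _)
      (card_patterns_le hn hd0 (by positivity) hbR hdR _ fun g hg => by
        convert hsupp g hg) hE)

/-! ### Finiteness of the dimension. -/

/-- A class with arbitrarily large shattered sets deviates from its means on every sample of size
`n` from the uniform distribution on a large shattered set. -/
lemma exists_deviation {T : Type*} {M : ℝ} {F : Set (T → ℝ)}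
    (hF : ∀ f ∈ F, ∀ t : T, f t ∈ Set.Icc (-M) M) {γ : ℝ} (hγ : 0 < γ) {s : Finset T}
    (hs : FatShatters (Set.Icc (-M) M) F γ s) {n N : ℕ} (hn : 0 < n)
    (hN : 2 * M * n < γ * N) (e : Fin N → s) (he : Function.Injective e) (ω : ℕ → Fin N) :
    ∃ f ∈ F, γ / 2 < |(1 / (n : ℝ)) * ∑ i ∈ Finset.range n, f (e (ω i))
      - (1 / (N : ℝ)) * ∑ j, f (e j)| := by
  classical
  obtain ⟨-, b, hb, hl⟩ := hs
  have hn' : (0 : ℝ) < n := by exact_mod_cast hn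
  have hN0 : 0 < N := (ω 0).pos
  have hN' : (0 : ℝ) < N := by exact_mod_cast hN0
  set W : Finset (Fin N) := (Finset.range n).image ω with hW
  have hWc : (W.card : ℝ) ≤ n := by
    have : W.card ≤ n := by simpa using Finset.card_image_le (s := Finset.range n) (f := ω)
    exact_mod_cast this
  -- Sign `+1` exactly on the visited points; `g` below realizes the opposite signs.
  set l : T → ℝ := fun τ => if ∃ j ∈ W, (e j : T) = τ then 1 else -1 with hldef
  have hle : ∀ j, l (e j) = if j ∈ W then 1 else -1 := by
    intro j
    have : (∃ j' ∈ W, (e j' : T) = e j) ↔ j ∈ W :=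
      ⟨fun ⟨j', hj', h⟩ => he (Subtype.ext h) ▸ hj', fun h => ⟨j, h, rfl⟩⟩
    simp only [hldef, this]
  obtain ⟨f, hf, hfl⟩ := hl l fun τ _ => by
    simp only [hldef]; split_ifs <;> simp
  obtain ⟨g, hg, hgl⟩ := hl (fun τ => -l τ) fun τ _ => by
    simp only [hldef]; split_ifs <;> simp
  have hin : ∀ j ∈ W, 2 * γ ≤ f (e j) - g (e j) := by
    intro j hj
    have h1 := hfl (e j) (e j).2
    have h2 := hgl (e j) (e j).2
    rw [hle, if_pos hj] at h1 h2
    linarith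
  have hout : ∀ j, f (e j) - g (e j) ≤ if j ∈ W then 2 * M else 0 := by
    intro j
    split_ifs with hj
    · linarith [(hF f hf (e j)).2, (hF g hg (e j)).1]
    · have h1 := hfl (e j) (e j).2
      have h2 := hgl (e j) (e j).2
      rw [hle, if_neg hj] at h1 h2
      linarith
  have hMnonneg : 0 ≤ M := by
    have := hb _ (e (ω 0)).2
    linarith [this.1, this.2]
  have hemp : 2 * γ ≤ (1 / (n : ℝ)) * ∑ i ∈ Finset.range n, f (e (ω i)) -
      (1 / (n : ℝ)) * ∑ i ∈ Finset.range n, g (e (ω i)) := by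
    rw [← mul_sub, ← Finset.sum_sub_distrib]
    have : ∑ i ∈ Finset.range n, 2 * γ ≤
        ∑ i ∈ Finset.range n, (f (e (ω i)) - g (e (ω i))) :=
      Finset.sum_le_sum fun i hi => hin _ (Finset.mem_image_of_mem ω hi)
    rw [Finset.sum_const, Finset.card_range, nsmul_eq_mul] at this
    rw [one_div, inv_mul_eq_div, le_div_iff₀ hn']
    linarith
  have hmean : (1 / (N : ℝ)) * ∑ j, f (e j) - (1 / (N : ℝ)) * ∑ j, g (e j) < γ := by
    rw [← mul_sub, ← Finset.sum_sub_distrib]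
    have : ∑ j, (f (e j) - g (e j)) ≤ ∑ j, if j ∈ W then 2 * M else 0 :=
      Finset.sum_le_sum fun j _ => hout j
    rw [Finset.sum_ite_mem, Finset.univ_inter, Finset.sum_const, nsmul_eq_mul] at this
    rw [one_div, inv_mul_eq_div, div_lt_iff₀ hN']
    nlinarith
  by_contra! hcon
  have h1 := (abs_le.1 (hcon f hf)).2
  have h2 := (abs_le.1 (hcon g hg)).1
  linarith

/-- A uniform Glivenko-Cantelli class of bounded functions has finite fat-shattering dimensions. -/
lemma IsUniformGC.fatDim_ne_top {T : Type*} [MeasurableSpace T] {M : ℝ} {F : Set (T → ℝ)}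
    (hF : ∀ f ∈ F, ∀ t : T, f t ∈ Set.Icc (-M) M) (hGC : IsUniformGC F) {γ : ℝ} (hγ : 0 < γ) :
    fatDim (Set.Icc (-M) M) F γ ≠ ⊤ := by
  intro htop
  have hev := (ENNReal.tendsto_nhds_zero.1 (hGC.2 (γ / 2) (by positivity))) (1 / 2) (by simp)
  obtain ⟨n, hn, hn0⟩ := (hev.and (Filter.eventually_gt_atTop 0)).exists
  obtain ⟨N₀, hN₀⟩ := exists_nat_gt (2 * M * n / γ)
  obtain ⟨s, hs⟩ := iSup_eq_top.1 htop N₀ (ENat.natCast_lt_top _)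
  obtain ⟨hsh, hcard⟩ := lt_iSup_iff.1 hs
  have hcard' : N₀ < s.card := by exact_mod_cast hcard
  set N := s.card with hNdef
  have hN0 : 0 < N := by omega
  have hNM : 2 * M * n < γ * N := by
    rw [div_lt_iff₀ hγ] at hN₀
    have : (N₀ : ℝ) < N := by exact_mod_cast hcard'
    nlinarith
  set e : Fin N → s := fun j => s.equivFin.symm j
  have he : Function.Injective e := s.equivFin.symm.injective
  -- Sampling from the discrete space `Fin N` avoids assuming measurable singletons in `T`.
  set ν : Measure (Fin N) := (N : ℝ≥0∞)⁻¹ • Measure.count with hν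
  have hνp : IsProbabilityMeasure ν := ⟨by
    rw [hν, Measure.smul_apply, Measure.count_univ, ENat.card_eq_coe_fintype_card,
      Fintype.card_fin, smul_eq_mul]
    exact ENNReal.inv_mul_cancel (by exact_mod_cast hN0.ne') (by simp)⟩
  have hmeas : Measurable fun j : Fin N => (e j : T) := measurable_from_top
  have hPp : IsProbabilityMeasure (ν.map fun j => (e j : T)) :=
    Measure.isProbabilityMeasure_map hmeas.aemeasurable
  have hle := (le_iSup (fun P : ProbabilityMeasure T =>
    (Measure.infinitePi fun _ : ℕ => (P : Measure T))
          {ω : ℕ → T | ∃ n' : ℕ, n ≤ n' ∧ ∃ f ∈ F,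
            γ / 2 < |(1 / (n' : ℝ)) * ∑ i ∈ Finset.range n', f (ω i)
                  - ∫ t, f t ∂(P : Measure T)|}) ⟨_, hPp⟩).trans hn
  simp only [ProbabilityMeasure.coe_mk] at hle
  rw [← Measure.infinitePi_map_pi (fun _ : ℕ => ν) (fun _ => hmeas)] at hle
  -- The event need not be measurable, but its preimage in index sequences is everything, so its
  -- outer measure is `1`.
  have hle' := (Measure.le_map_apply (μ := Measure.infinitePi fun _ : ℕ => ν)
    (f := fun (ω : ℕ → Fin N) i => (e (ω i) : T))
    (measurable_pi_lambda _ fun i => hmeas.comp (measurable_pi_apply i)).aemeasurable _).trans hle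
  rw [Set.eq_univ_of_forall (s := _ ⁻¹' _), measure_univ] at hle'
  · exact absurd hle' (by norm_num)
  · intro ω
    obtain ⟨f, hf, hdev⟩ := exists_deviation hF hγ hsh hn0 hNM e he ω
    refine ⟨n, le_rfl, f, hf, ?_⟩
    rw [integral_map hmeas.aemeasurable (hGC.1 f hf).aestronglyMeasurable, hν,
      integral_smul_measure, integral_count]
    simpa using hdev

end

/-! ### Reduction to finite classes, and numerical estimates. -/

/-- A separated set with more than `⌊X⌋₊` elements, even an infinite one, contains a finite one with
exactly `⌊X⌋₊ + 1`. -/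
lemma uniformPackingNum_le {T : Type*} {p : ℕ∞} {ε : ℝ} {F : Set (T → ℝ)} {n : ℕ} {X : ℝ}
    (hX : 0 ≤ X) (h : ∀ (t : Fin n → T) (A : Finset (T → ℝ)), ↑A ⊆ F →
      (∀ f ∈ A, ∀ g ∈ A, f ≠ g → ε ≤ empDist p t f g) → (A.card : ℝ) ≤ X) :
    (uniformPackingNum p ε F n : ℝ≥0∞) ≤ ENNReal.ofReal X := by
  have h1 : uniformPackingNum p ε F n ≤ (⌊X⌋₊ : ℕ) := by
    refine iSup_le fun t => iSup₂_le fun B hB => ?_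
    by_contra! hlt
    obtain ⟨C, hCB, hC⟩ := Set.exists_subset_encard_eq (Order.add_one_le_of_lt hlt)
    have hfin : C.Finite := by
      rw [← Set.encard_ne_top_iff, hC]
      exact_mod_cast ENat.natCast_ne_top (⌊X⌋₊ + 1)
    have hcard : hfin.toFinset.card = ⌊X⌋₊ + 1 := by
      rw [hfin.encard_eq_coe_toFinset_card] at hC
      exact_mod_cast hC
    have := h t hfin.toFinset (by simpa using hCB.trans hB.1) fun f hf g hg hfg =>
      hB.2 f (hCB (by simpa using hf)) g (hCB (by simpa using hg)) hfg
    rw [hcard] at this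
    exact absurd (Nat.le_floor this) (by omega)
  calc (uniformPackingNum p ε F n : ℝ≥0∞) ≤ ((⌊X⌋₊ : ℕ∞) : ℝ≥0∞) := ENat.toENNReal_le.2 h1
    _ = ENNReal.ofReal (⌊X⌋₊ : ℝ) := by simp
    _ ≤ _ := ENNReal.ofReal_le_ofReal (Nat.floor_le hX)

open Classical in
lemma one_le_card_of_le_empDist_top {T : Type*} {n : ℕ} (hn : 0 < n) {t : Fin n → T}
    {f g : T → ℝ} {ε : ℝ} (h : ε ≤ empDist ⊤ t f g) :
    1 ≤ (Finset.univ.filter fun i => ε ≤ |f (t i) - g (t i)|).card := by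
  have : Nonempty (Fin n) := ⟨⟨0, hn⟩⟩
  rw [empDist, if_pos rfl] at h
  obtain ⟨i, hi⟩ := exists_eq_ciSup_of_finite (f := fun i : Fin n => |f (t i) - g (t i)|)
  refine Finset.card_pos.2 ⟨i, Finset.mem_filter.2 ⟨Finset.mem_univ _, ?_⟩⟩
  rw [← hi] at h
  exact h

open Classical in
/-- Functions at `L_p` distance at least `ε` differ by at least `ε / 2` on a proportion of the
points. -/
lemma le_card_of_le_empDist {T : Type*} {M : ℝ} (hM : 0 < M) {n p : ℕ} (hn : 0 < n) (hp : 1 ≤ p)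
    {t : Fin n → T} {f g : T → ℝ} (hf : ∀ t, f t ∈ Set.Icc (-M) M)
    (hg : ∀ t, g t ∈ Set.Icc (-M) M) {ε : ℝ} (hε : 0 < ε) (h : ε ≤ empDist p t f g) :
    1 / (2 * (2 * M / ε) ^ p) * n ≤
      ((Finset.univ.filter fun i => ε / 2 ≤ |f (t i) - g (t i)|).card : ℝ) := by
  have hn' : (0 : ℝ) < n := by exact_mod_cast hn
  have hp' : (p : ℝ) ≠ 0 := by positivity
  rw [empDist, if_neg (ENat.natCast_ne_top p), ENat.toNat_natCast] at h
  set S := ∑ i : Fin n, |f (t i) - g (t i)| ^ p with hS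
  have hS0 : 0 ≤ S := Finset.sum_nonneg fun i _ => by positivity
  have h1 : ε ^ p ≤ 1 / (n : ℝ) * S := by
    calc ε ^ p ≤ ((1 / (n : ℝ) * S) ^ (1 / (p : ℝ))) ^ p := pow_le_pow_left₀ hε.le h p
      _ = _ := by
        rw [one_div (p : ℝ), Real.rpow_inv_natCast_pow (by positivity) (by omega)]
  set C := Finset.univ.filter fun i => ε / 2 ≤ |f (t i) - g (t i)| with hC
  have h2 : S ≤ C.card * (2 * M) ^ p + n * (ε / 2) ^ p := by
    have : ∀ i, |f (t i) - g (t i)| ^ p ≤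
        (if ε / 2 ≤ |f (t i) - g (t i)| then (2 * M) ^ p else 0) + (ε / 2) ^ p := by
      intro i
      split_ifs with hi
      · have : |f (t i) - g (t i)| ≤ 2 * M := abs_le.2
          ⟨by linarith [(hf (t i)).1, (hg (t i)).2], by linarith [(hf (t i)).2, (hg (t i)).1]⟩
        have := pow_le_pow_left₀ (abs_nonneg _) this p
        have : 0 ≤ (ε / 2) ^ p := by positivity
        linarith
      · rw [zero_add]
        exact pow_le_pow_left₀ (abs_nonneg _) (not_le.1 hi).le p
    calc S ≤ _ := Finset.sum_le_sum fun i _ => this i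
      _ = _ := by
        rw [Finset.sum_add_distrib, ← Finset.sum_filter, Finset.sum_const, Finset.sum_const,
          Finset.card_univ, Fintype.card_fin, nsmul_eq_mul, nsmul_eq_mul]
  have h3 : (ε / 2) ^ p ≤ ε ^ p / 2 := by
    rw [div_pow]
    refine div_le_div_of_nonneg_left (by positivity) (by norm_num) ?_
    calc (2 : ℝ) = 2 ^ 1 := (pow_one _).symm
      _ ≤ _ := pow_le_pow_right₀ (by norm_num) hp
  rw [one_div, inv_mul_eq_div, le_div_iff₀ hn'] at h1
  have h4 : (n : ℝ) * ε ^ p ≤ C.card * (2 * M) ^ p * 2 := by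
    have := mul_le_mul_of_nonneg_left h3 hn'.le
    linarith
  rw [div_pow, one_div, inv_mul_eq_div, div_le_iff₀ (by positivity)]
  have heq : (C.card : ℝ) * (2 * ((2 * M) ^ p / ε ^ p)) = C.card * (2 * M) ^ p * 2 / ε ^ p := by
    ring
  rw [heq, le_div_iff₀ (by positivity)]
  exact h4

/-- Since `log z ≤ z / 2 - 1 + log 2 < z / 2`, half of `z` is absorbed on the left. -/
lemma le_two_mul_log_of_le_log {C z : ℝ} (hC : 0 < C) (hz : 0 < z) (h : z ≤ Real.log (C * z)) :
    z ≤ 2 * Real.log C := by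
  rw [Real.log_mul hC.ne' hz.ne'] at h
  have h1 := Real.log_le_sub_one_of_pos (show 0 < z / 2 by positivity)
  rw [Real.log_div hz.ne' two_ne_zero] at h1
  have h2 := Real.log_two_lt_d9
  linarith

lemma le_two_pow_sauerK {M ε : ℝ} (hM : 0 < M) (hε : 0 < ε) (p : ℕ) :
    (112 * M / ε) ^ (p + 2) ≤ (2 : ℝ) ^ sauerK M ε p := by
  have h0 : 0 < 112 * M / ε := by positivity
  set c : ℝ := ((⌈112 * M / ε⌉ : ℤ) : ℝ)
  have hc : 112 * M / ε ≤ c := Int.le_ceil _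
  have hc0 : 0 < c := h0.trans_le hc
  calc (112 * M / ε) ^ (p + 2) ≤ c ^ (p + 2) := pow_le_pow_left₀ h0.le hc _
    _ = (2 : ℝ) ^ (((p : ℝ) + 2) * Real.logb 2 c) := by
      rw [mul_comm, Real.rpow_mul (by norm_num), Real.rpow_logb (by norm_num) (by norm_num) hc0,
        ← Real.rpow_natCast]
      push_cast; rfl
    _ ≤ (2 : ℝ) ^ (sauerK M ε p : ℝ) :=
      Real.rpow_le_rpow_of_exponent_le (by norm_num) (Nat.le_ceil _)
    _ = _ := Real.rpow_natCast _ _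

lemma one_le_sauerK {M ε : ℝ} (hM : 0 < M) (hε : 0 < ε) (hεM : ε ≤ 2 * M) (p : ℕ) :
    1 ≤ sauerK M ε p := by
  by_contra! h
  have h1 := le_two_pow_sauerK hM hε p
  have h2 : 56 ≤ 112 * M / ε := by rw [le_div_iff₀ hε]; linarith
  rw [Nat.lt_one_iff.1 h, pow_zero] at h1
  have := pow_le_pow_left₀ (by norm_num) h2 (p + 2)
  have := one_lt_pow₀ (show (1 : ℝ) < 56 by norm_num) (show p + 2 ≠ 0 by omega)
  linarith

/-! ### The two packing bounds. -/

section

variable {T : Type*} {M : ℝ} {F : Set (T → ℝ)} {ε : ℝ} {n : ℕ} {d : ℕ}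

/-- The `L_∞` packing bound in terms of the fat-shattering dimension. -/
lemma card_le_of_empDist_top (hM : 0 < M) (hF : ∀ f ∈ F, ∀ t : T, f t ∈ Set.Icc (-M) M)
    (hε : 0 < ε) (hεM : ε ≤ 2 * M) (hn : 1 ≤ n)
    (hd : fatDim (Set.Icc (-M) M) F (ε / 4) ≤ d) (hdn : ε * d ≤ 4 * M * n) (t : Fin n → T)
    (A : Finset (T → ℝ)) (hAF : ↑A ⊆ F)
    (hA : ∀ f ∈ A, ∀ g ∈ A, f ≠ g → ε ≤ empDist ⊤ t f g) :
    (A.card : ℝ) ≤ (16 * M ^ 2 * n / ε ^ 2) ^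
      (d * Real.logb 2 (4 * M * Real.exp 1 * n / (d * ε))) := by
  classical
  have hn1 : (1 : ℝ) ≤ n := by exact_mod_cast hn
  have hn' : (0 : ℝ) < n := by linarith
  set R : ℝ := 2 * M / (ε / 2) with hR
  have hR2 : 2 ≤ R := by rw [hR, le_div_iff₀ (by positivity)]; linarith
  set N : ℝ := 16 * M ^ 2 * n / ε ^ 2 with hN
  have hNR : N = n * R ^ 2 := by rw [hN, hR]; field_simp; ring
  have hN1 : 1 ≤ N := by rw [hNR]; nlinarith
  have hL : 4 * R ≤ (4 : ℝ) ^ Real.logb 2 N * (1 / n) := by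
    have h4 : (4 : ℝ) ^ Real.logb 2 N = N ^ 2 := by
      rw [show (4 : ℝ) = 2 ^ (2 : ℝ) by norm_num, ← Real.rpow_mul (by norm_num), mul_comm,
        Real.rpow_mul (by norm_num), Real.rpow_logb (by norm_num) (by norm_num) (by linarith),
        Real.rpow_two]
    rw [h4, hNR, mul_one_div, le_div_iff₀ hn']
    have h1 : 4 ≤ R ^ 2 := by nlinarith
    have h2 : R ≤ R ^ 2 := by nlinarith
    have h3 : (n : ℝ) ≤ n ^ 2 := by nlinarith
    calc 4 * R * n ≤ R ^ 2 * R ^ 2 * n ^ 2 := by gcongr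
      _ = _ := by ring
  obtain ⟨h0, h1⟩ := card_le_of_fatDim hM hF (Nat.lt_of_lt_of_le Nat.zero_lt_one hn) t
    (γ := ε / 4) (η := ε / 2) (σ := ε) (π := 1 / n) (E := Real.logb 2 N) (by positivity)
    (by positivity) (by linarith) (by positivity)
    (Real.logb_nonneg (by norm_num) hN1) hL hd hAF (fun f hf g hg hfg => by
      rw [one_div_mul_cancel hn'.ne']
      exact_mod_cast one_le_card_of_le_empDist_top (by omega) (hA f hf g hg hfg))
  rcases Nat.eq_zero_or_pos d with hd0 | hd0
  · have := h0 hd0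
    rw [hd0]
    simpa using this
  · have hd' : (0 : ℝ) < d := by exact_mod_cast hd0
    have hdR : (d : ℝ) ≤ n * R := by
      rw [hR, ← mul_div_assoc, le_div_iff₀ (by positivity)]
      linarith
    refine (h1 hd0 hdR).trans (le_of_eq ?_)
    set y : ℝ := 4 * M * Real.exp 1 * n / (d * ε) with hy
    have hyR : Real.exp 1 * n * R / d = y := by rw [hy, hR]; field_simp; ring
    have hy0 : 0 < y := by rw [hy]; positivity
    have hN0 : 0 < N := by linarith
    rw [hyR]
    -- The identity `(y ^ d) ^ log₂ N = N ^ (d log₂ y)`.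
    refine Real.log_injOn_pos (Set.mem_Ioi.2 (by positivity)) (Set.mem_Ioi.2 (by positivity)) ?_
    rw [Real.log_rpow (by positivity), Real.log_pow, Real.log_rpow hN0, Real.logb, Real.logb]
    ring

/-- The dimension-free `L_p` packing bound in terms of the fat-shattering dimension. -/
lemma card_le_of_empDist (hM : 0 < M) (hF : ∀ f ∈ F, ∀ t : T, f t ∈ Set.Icc (-M) M)
    (hε : 0 < ε) (hεM : ε ≤ 2 * M) (hn : 1 ≤ n) {p : ℕ} (hp : 1 ≤ p)
    (hd : fatDim (Set.Icc (-M) M) F (ε / 45) ≤ d) (t : Fin n → T)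
    (A : Finset (T → ℝ)) (hAF : ↑A ⊆ F)
    (hA : ∀ f ∈ A, ∀ g ∈ A, f ≠ g → ε ≤ empDist p t f g) :
    (A.card : ℝ) ≤ (6272 * Real.exp 1 * sauerK M ε p / 3 * (2 * M / ε) ^ (2 * p + 1)) ^
      (2 * sauerK M ε p * d) := by
  classical
  set K := sauerK M ε p with hK
  have hK1 : (1 : ℝ) ≤ K := by exact_mod_cast one_le_sauerK hM hε hεM p
  have hK0 : (0 : ℝ) < K := by linarith
  set r : ℝ := 2 * M / ε with hr
  have hr1 : 1 ≤ r := by rw [hr, le_div_iff₀ hε]; linarith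
  have hr0 : 0 < r := by linarith
  have he : 1 ≤ Real.exp 1 := Real.one_le_exp (by norm_num)
  have hrp : 1 ≤ r ^ p := one_le_pow₀ hr1
  set B : ℝ := 6272 * Real.exp 1 * K / 3 * r ^ (2 * p + 1) with hB
  have hCB : 68 * Real.exp 1 * K * r ^ (p + 1) ≤ B := by
    have h1 : r ^ (p + 1) ≤ r ^ (2 * p + 1) := pow_le_pow_right₀ hr1 (by omega)
    have h2 : 0 ≤ Real.exp 1 * K := by positivity
    calc 68 * Real.exp 1 * K * r ^ (p + 1) = 68 * (Real.exp 1 * K) * r ^ (p + 1) := by ring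
      _ ≤ 6272 / 3 * (Real.exp 1 * K) * r ^ (2 * p + 1) := by gcongr; norm_num
      _ = B := by rw [hB]; ring
  have hBe : Real.exp 1 ≤ B := by
    refine le_trans ?_ hCB
    have h1 : 1 ≤ r ^ (p + 1) := one_le_pow₀ hr1
    calc Real.exp 1 = 1 * Real.exp 1 * 1 * 1 := by ring
      _ ≤ _ := by gcongr; norm_num
  have hB0 : 0 < B := by linarith
  have hlogB : 1 ≤ Real.log B := (Real.le_log_iff_exp_le hB0).2 hBe
  by_cases hm : A.card ≤ 1
  · calc (A.card : ℝ) ≤ 1 := by exact_mod_cast hm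
      _ ≤ _ := one_le_pow₀ (by linarith)
  have hm1 : (1 : ℝ) < A.card := by exact_mod_cast not_le.1 hm
  have hm0 : (0 : ℝ) < A.card := by linarith
  set Λ := Real.log A.card with hΛ
  have hΛ0 : 0 < Λ := Real.log_pos hm1
  suffices hsuff : Λ ≤ 2 * K * d * Real.log B by
    rw [← Real.log_le_log_iff hm0 (by positivity), Real.log_pow]
    push_cast
    exact hsuff
  have hL : 4 * (2 * M / (ε / 4)) ≤ (4 : ℝ) ^ (K : ℝ) * (1 / (2 * r ^ p) / 4) := by
    have h1 := le_two_pow_sauerK hM hε p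
    have h2 : (2 : ℝ) ^ K ≤ 4 ^ K := pow_le_pow_left₀ (by norm_num) (by norm_num) _
    have h3 : 112 * M / ε = 56 * r := by rw [hr]; ring
    rw [h3, mul_pow] at h1
    have h4 : 2 * M / (ε / 4) = 4 * r := by rw [hr]; field_simp
    rw [h4, Real.rpow_natCast, div_div, mul_one_div, le_div_iff₀ (by positivity)]
    have h5 : (56 : ℝ) ^ 2 ≤ 56 ^ (p + 2) := pow_le_pow_right₀ (by norm_num) (by omega)
    have h6 : r ^ (p + 1) ≤ r ^ (p + 2) := pow_le_pow_right₀ hr1 (by omega)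
    calc 4 * (4 * r) * (2 * r ^ p * 4) = 128 * r ^ (p + 1) := by ring
      _ ≤ 56 ^ (p + 2) * r ^ (p + 2) := by gcongr; linarith
      _ ≤ _ := h1.trans h2
  -- The least integer above `16 r^p Λ`: with `π = 1 / (2 r^p)` this is what `|A|² < exp (π q / 4)`
  -- requires.
  set q : ℕ := ⌊16 * r ^ p * Λ⌋₊ + 1 with hq
  have hqlow : 16 * r ^ p * Λ < q := by
    rw [hq]; push_cast; exact Nat.lt_floor_add_one _
  have hqup : (q : ℝ) ≤ 16 * r ^ p * Λ + 1 := by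
    rw [hq]; push_cast
    linarith [Nat.floor_le (show 0 ≤ 16 * r ^ p * Λ by positivity)]
  obtain ⟨s, hs⟩ := exists_sample (π := 1 / (2 * r ^ p)) (q := q) (by omega : 0 < n) A.offDiag
    (fun w i => ε / 2 ≤ |w.1 (t i) - w.2 (t i)|)
    (fun w hw => by
      obtain ⟨hf, hg, hfg⟩ := Finset.mem_offDiag.1 hw
      exact le_card_of_le_empDist hM (by omega) hp (hF _ (hAF hf)) (hF _ (hAF hg)) hε
        (hA _ hf _ hg hfg))
    (by
      have h1 : (A.offDiag.card : ℝ) ≤ (A.card : ℝ) ^ 2 := by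
        rw [Finset.offDiag_card, sq]
        exact_mod_cast Nat.sub_le _ _
      refine h1.trans_lt ?_
      rw [← Real.exp_log (show (0 : ℝ) < (A.card : ℝ) ^ 2 by positivity), Real.exp_lt_exp,
        Real.log_pow, ← hΛ, one_div, inv_mul_eq_div, div_div, lt_div_iff₀ (by positivity)]
      push_cast
      linarith)
  obtain ⟨h0, h1⟩ := card_le_of_fatDim hM hF (n := q) (by omega) (fun j => t (s j))
    (γ := ε / 45) (η := ε / 4) (σ := ε / 2) (π := 1 / (2 * r ^ p) / 4) (E := K) (by positivity)
    (by positivity) (by linarith) (by positivity) (by positivity) hL hd hAF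
    (fun f hf g hg hfg => hs (f, g) (Finset.mem_offDiag.2 ⟨hf, hg, hfg⟩))
  rcases Nat.eq_zero_or_pos d with hd0 | hd0
  · exact absurd (h0 hd0) hm
  have hd' : (0 : ℝ) < d := by exact_mod_cast hd0
  have hd1 : (1 : ℝ) ≤ d := by exact_mod_cast hd0
  -- If `Λ ≤ d`, the bound follows from `K ≥ 1` and `log B ≥ 1`. Otherwise `Λ ≥ 1` absorbs the
  -- rounding in `q`, and `q ≥ d` permits the pattern count.
  rcases le_total Λ d with hΛd | hΛd
  · have : 1 * (d : ℝ) * 1 ≤ 2 * K * d * Real.log B := by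
      gcongr
      linarith
    linarith
  have hR : 2 * M / (ε / 4) = 4 * r := by rw [hr]; field_simp
  rw [hR] at h1
  have hqΛ : Λ ≤ q := by nlinarith
  have hbound := h1 hd0 (by nlinarith)
  have hq0 : (0 : ℝ) < q := by linarith
  have hlog : Λ ≤ K * (d * Real.log (Real.exp 1 * q * (4 * r) / d)) := by
    have := Real.log_le_log hm0 hbound
    rwa [Real.log_rpow (by positivity), Real.log_pow] at this
  -- This scaling makes the inequality self-referential, `z ≤ log (C z)`, with `68 = 17 · 4` in `C`.
  set z : ℝ := Λ / (K * d) with hz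
  have hz0 : 0 < z := by positivity
  have hzlog : z ≤ Real.log (68 * Real.exp 1 * K * r ^ (p + 1) * z) := by
    calc z ≤ Real.log (Real.exp 1 * q * (4 * r) / d) := by
          rw [hz, div_le_iff₀ (by positivity)]
          linarith
      _ ≤ _ := by
        refine Real.log_le_log (by positivity) ?_
        have hq17 : (q : ℝ) ≤ 17 * r ^ p * Λ := by nlinarith
        calc Real.exp 1 * q * (4 * r) / d
            ≤ Real.exp 1 * (17 * r ^ p * Λ) * (4 * r) / d := by gcongr
          _ = _ := by rw [hz]; field_simp; ring
  have hfin := le_two_mul_log_of_le_log (by positivity) hz0 hzlog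
  have hfin' : z ≤ 2 * Real.log B :=
    hfin.trans (by linarith [Real.log_le_log (by positivity) hCB])
  rw [hz, div_le_iff₀ (by positivity)] at hfin'
  linarith

end

/-! ### The main theorem. -/

theorem lemma2 {T : Type*} [MeasurableSpace T] (M : ℝ) (hM : 0 < M)
    (F : Set (T → ℝ)) (hF : ∀ f ∈ F, ∀ t : T, f t ∈ Set.Icc (-M) M) (hGC : IsUniformGC F)
    (d : ℝ → ℕ∞) (hd : ∀ γ : ℝ, d γ = fatDim (Set.Icc (-M) M) F γ) :
    (∀ γ ∈ Set.Ioc (0 : ℝ) M, d γ ≠ ⊤) ∧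
    ∀ ε ∈ Set.Ioc (0 : ℝ) (2 * M), ∀ n : ℕ, 1 ≤ n →
      (∀ p : ℕ, 1 ≤ p →
        (uniformPackingNum (p : ℕ∞) ε F n : ℝ≥0∞) ≤
          ENNReal.ofReal
            ((2 : ℝ) ^ (2 * (sauerK M ε p + 1)) *
              (6272 * Real.exp 1 * (sauerK M ε p : ℝ) / 3 * (2 * M / ε) ^ (2 * p + 1)) ^
                (2 * sauerK M ε p * (d (ε / 45)).toNat))) ∧
      (ε * ((d (ε / 4)).toNat : ℝ) ≤ 4 * M * (n : ℝ) →
        (uniformPackingNum ⊤ ε F n : ℝ≥0∞) ≤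
          ENNReal.ofReal
            (2 * (16 * M ^ 2 * (n : ℝ) / ε ^ 2) ^
              (((d (ε / 4)).toNat : ℝ) *
                Real.logb 2 (4 * M * Real.exp 1 * (n : ℝ) / (((d (ε / 4)).toNat : ℝ) * ε))))) := by
  have htop : ∀ γ : ℝ, 0 < γ → d γ ≠ ⊤ := fun γ hγ => by
    rw [hd]
    exact hGC.fatDim_ne_top hF hγ
  have hdim : ∀ γ : ℝ, 0 < γ → fatDim (Set.Icc (-M) M) F γ ≤ ((d γ).toNat : ℕ) := fun γ hγ => by
    rw [ENat.natCast_toNat (htop γ hγ), hd]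
  refine ⟨fun γ hγ => htop γ hγ.1, fun ε hε n hn => ?_⟩
  obtain ⟨hε0, hεM⟩ := hε
  refine ⟨fun p hp => ?_, fun hdn => ?_⟩
  · refine uniformPackingNum_le (by positivity) fun t A hAF hA => ?_
    have h := card_le_of_empDist hM hF hε0 hεM hn hp (hdim _ (by positivity)) t A hAF hA
    -- The prefactor `2 ^ (2 (K + 1))` is pure slack, as is the factor `2` in the `L_∞` case.
    exact h.trans (le_mul_of_one_le_left (by positivity) (one_le_pow₀ (by norm_num)))
  · refine uniformPackingNum_le (by positivity) fun t A hAF hA => ?_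
    have h := card_le_of_empDist_top hM hF hε0 hεM hn (hdim _ (by positivity)) hdn t A hAF hA
    exact h.trans (le_mul_of_one_le_left (by positivity) (by norm_num))
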